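/- Let $N\ge 1$, $0<p<1$, $q=1-p$. A point $(x,t)\in\mathbb Z^2$ stands for site $x$ at time $t$. An $N$-point configuration $(\bm x,\bm t)=((x_1,t_1),\dots,(x_N,t_N))$ is called admissible if $x_1>\dots>x_N$ and $t_1\le\dots\le t_N$. Paths and weights. A path from $(x^0,t^0)$ to $(x,t)$, where $t\ge t^0$, is a set $\{(x^s,s): t^0\le s\le t\}$ with $x^{t^0}=x^0$, $x^t=x$ and arbitrary integers $x^s$ in between (a single point if $t=t^0$). An $N$-path $\bm\Pi=(\Pi_1,\dots,\Pi_N)$ from $(\bm x^0,\bm t^0)$ to $(\bm x,\bm t)$ consists of paths $\Pi_i$ from $(x_i^0,t_i^0)$ to $(x_i,t_i)$. Its weight $W[\bm\Pi]$ is the product over $i$ and over the steps of $\Pi_i$ of the following elementary weights, where $\Pi_0=\emptyset$: a step $(x,t)\to(x+1,t+1)$ of $\Pi_i$ has weight $p$ if $(x+1,t+1)\notin\Pi_{i-1}$ and $0$ otherwise; a step $(x,t)\to(x,t+1)$ of $\Pi_i$ has weight $q$ if $(x+1,t+1)\notin\Pi_{i-1}$ and $1$ otherwise; every other step has weight $0$.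 The generalized Green function (GGF) $G((\bm x,\bm t)|(\bm x^0,\bm t^0))$ is the sum of $W[\bm\Pi]$ over all $N$-paths from $(\bm x^0,\bm t^0)$ to $(\bm x,\bm t)$ (zero if there are none). If $t_i''=t_i'+1$ for all $i$, then $W(\{(\bm x',\bm t'),(\bm x'',\bm t'')\})$ denotes the weight of the $N$-path consisting of the single steps $(x'_i,t'_i)\to(x''_i,t''_i)$. Boundaries. Let $\mathcal B=\{(b_k,s_k)\}_{k\in\mathbb Z}\subset\mathbb Z^2$ be such that for every $k$ either $(b_{k+1},s_{k+1})=(b_k+1,s_k)$ or $(b_{k+1},s_{k+1})=(b_k,s_k-1)$. Let $\mathcal B_i=\{(x-i+1,t):(x,t)\in\mathcal B\}$ for $i=1,\dots,N$, let $\bm{\mathcal B}=(\mathcal B_1,\dots,\mathcal B_N)$, and let $\tilde L_i=\{(x',t'): x'\le x,\ t'\le t \text{ for some } (x,t)\in\mathcal B_i\}$. An admissible configuration on $\bm{\mathcal B}$ is an admissible $(\bm x',\bm t')$ with $(x_i',t_i')\in\mathcal B_i$ for all $i$. Its exit probability is $$P_e^{\bm{\mathcal B}}((\bm x',\bm t'))=\sum_{(\bm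 x'',\bm t'')} W(\{(\bm x',\bm t'),(\bm x'',\bm t'')\}),$$ the sum being over all $(\bm x'',\bm t'')$ with $t_i''=t_i'+1$ and $(x_i'',t_i'')\notin\tilde L_i$ for all $i$. Statement. Let $(\bm x^0,\bm t^0)$ be admissible with $(x_i^0,t_i^0)\in\tilde L_i$ for all $i$. (1) The quantity $$\mathcal G^{\bm{\mathcal B}}((\bm x,\bm t)|(\bm x^0,\bm t^0))=P_e^{\bm{\mathcal B}}((\bm x,\bm t))\,G((\bm x,\bm t)|(\bm x^0,\bm t^0))$$ defines a probability measure on the set of admissible configurations on $\bm{\mathcal B}$; that is, its values are nonnegative and their sum over all admissible configurations $(\bm x,\bm t)$ on $\bm{\mathcal B}$ is $1$. (2) For every admissible $(\bm x,\bm t)$ with $(x_i,t_i)\notin\tilde L_i$ for all $i$, $$G((\bm x,\bm t)|(\bm x^0,\bm t^0))=\sum G((\bm x,\bm t)|(\bm x'',\bm t''))\,W(\{(\bm x',\bm t'),(\bm x'',\bm t'')\})\,G((\bm x',\bm t')|(\bm x^0,\bm t^0)),$$ the sum being over all admissible configurations $(\bm x',\bm t')$ on $\bm{\mathcal B}$ and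 all $(\bm x'',\bm t'')$ with $t_i''=t_i'+1$ and $(x_i'',t_i'')\notin\tilde L_i$ for all $i$. -/

import Mathlib

noncomputable section

namespace TASEP

/-- An indexed `N`-tuple of space-time points; a point is a pair `(x, t)` = (site, time). -/
abbrev Config (N : ℕ) : Type := Fin N → ℤ × ℤ

/-- Admissible configurations: `x₁ > x₂ > ⋯ > x_N` and `t₁ ≤ t₂ ≤ ⋯ ≤ t_N`. -/
def Admissible {N : ℕ} (c : Config N) : Prop :=
  StrictAnti (fun i => (c i).1) ∧ Monotone (fun i => (c i).2)

open Classical in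
/-- The elementary weight of the step from `a` to `b`, given the path `S` of the preceding
particle (`S = ∅` if there is none): a jump has weight `p`, or `0` if its target lies on `S`;
staying put has weight `q = 1 - p`, or `1` if the target of the jump lies on `S`;
all other steps have weight `0`. -/
def elemWeight (p : ℝ) (S : Set (ℤ × ℤ)) (a b : ℤ × ℤ) : ℝ :=
  if b = (a.1 + 1, a.2 + 1) then (if (a.1 + 1, a.2 + 1) ∈ S then 0 else p)
  else if b = (a.1, a.2 + 1) then (if (a.1 + 1, a.2 + 1) ∈ S then 1 else 1 - p)
  else 0

/-- An `N`-path from `c₀` to `c`. The `i`-th path is recorded by its position `pos i s` at every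
time `s` of the window from `(c₀ i).2` to `(c i).2`; so that different records are different
paths, `pos i` is extended by constants outside of the window. The positions strictly inside
the window are arbitrary. -/
structure NPath {N : ℕ} (c₀ c : Config N) where
  /-- positions of the particles -/
  pos : Fin N → ℤ → ℤ
  time_le : ∀ i, (c₀ i).2 ≤ (c i).2
  pos_start : ∀ i s, s ≤ (c₀ i).2 → pos i s = (c₀ i).1
  pos_end : ∀ i s, (c i).2 ≤ s → pos i s = (c i).1

/-- The set of points of the `i`-th path, for paths from `c₀` to `c` with positions `pos`. -/
def pathPoints {N : ℕ} (c₀ c : Config N) (pos : Fin N → ℤ → ℤ) (i : Fin N) : Set (ℤ × ℤ) :=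
  {z | (c₀ i).2 ≤ z.2 ∧ z.2 ≤ (c i).2 ∧ z.1 = pos i z.2}

/-- The path of the particle that precedes the `i`-th one; empty for the first particle. -/
def precedingPath {N : ℕ} (c₀ c : Config N) (pos : Fin N → ℤ → ℤ) (i : Fin N) : Set (ℤ × ℤ) :=
  {z | ∃ j : Fin N, j.val + 1 = i.val ∧ z ∈ pathPoints c₀ c pos j}

/-- The weight `W[Π₁] ∏ W[Π_{i+1} | Π_i]` of the `N`-path from `c₀` to `c` with positions
`pos`. -/
def pathWeight {N : ℕ} (p : ℝ) (c₀ c : Config N) (pos : Fin N → ℤ → ℤ) : ℝ :=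
  ∏ i, ∏ s ∈ Finset.Ico (c₀ i).2 (c i).2,
    elemWeight p (precedingPath c₀ c pos i) (pos i s, s) (pos i (s + 1), s + 1)

/-- The generalized Green function `G(c | c₀)`: the sum of the weights of all `N`-paths from `c₀`
to `c` (only finitely many weights are nonzero). -/
def GGF {N : ℕ} (p : ℝ) (c c₀ : Config N) : ℝ :=
  ∑' π : NPath c₀ c, pathWeight p c₀ c π.pos

/-- The weight `W({c', c''})` of the `N`-path that consists of the single steps from `c' i`
to `c'' i`, where `c''` lies one time unit after `c'`. -/
def stepWeight {N : ℕ} (p : ℝ) (c' c'' : Config N) : ℝ :=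
  pathWeight p c' c'' (fun i s => if s ≤ (c' i).2 then (c' i).1 else (c'' i).1)

/-- Boundaries: bi-infinite staircases each of whose steps goes one site to the right or one
time unit down. -/
def IsBoundary (B : Set (ℤ × ℤ)) : Prop :=
  ∃ b : ℤ → ℤ × ℤ, Set.range b = B ∧
    ∀ i, b (i + 1) = ((b i).1 + 1, (b i).2) ∨ b (i + 1) = ((b i).1, (b i).2 - 1)

/-- The domain `L̃` that is bounded by `B`. -/
def under (B : Set (ℤ × ℤ)) : Set (ℤ × ℤ) :=
  {z | ∃ b ∈ B, z.1 ≤ b.1 ∧ z.2 ≤ b.2}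

/-- The translation `T_n` of a set of space-time points by `n` steps in space. -/
def translate (n : ℤ) (B : Set (ℤ × ℤ)) : Set (ℤ × ℤ) :=
  (fun z : ℤ × ℤ => (z.1 + n, z.2)) '' B

/-- The `N`-boundary `(B, T_{-1} B, …, T_{-N+1} B)`. -/
def NBoundary (N : ℕ) (B : Set (ℤ × ℤ)) : Fin N → Set (ℤ × ℤ) :=
  fun i => translate (-(i.val : ℤ)) B

/-- The admissible configurations on the `N`-boundary of `B`. -/
def BoundaryConfig (N : ℕ) (B : Set (ℤ × ℤ)) : Type :=
  {c : Config N // Admissible c ∧ ∀ i, c i ∈ NBoundary N B i}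

/-- The configurations one time unit after `c'` whose `i`-th point is outside of the domain
bounded by the `i`-th boundary, for every `i`. -/
def ExitTarget {N : ℕ} (B : Set (ℤ × ℤ)) (c' : Config N) : Type :=
  {c'' : Config N // ∀ i, (c'' i).2 = (c' i).2 + 1 ∧ c'' i ∉ under (NBoundary N B i)}

/-- The exit probability `P_e`: the total weight of the steps from `c'` that leave. -/
def exitProb {N : ℕ} (p : ℝ) (B : Set (ℤ × ℤ)) (c' : Config N) : ℝ :=
  ∑' c'' : ExitTarget B c', stepWeight p c' c''.1

end TASEP

end

/-!
A path of nonzero weight stays or jumps to the right at every step. Hence it leaves the lower set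
bounded by a staircase exactly once, with a step that starts on the staircase. The domain of each
particle is the domain of its predecessor moved by one site to the left, so the target of a jump
before (at, after) the exit step of a particle can be occupied by the path of its predecessor only
before (at, after) the exit step of the predecessor; the weight of an `N`-path is therefore the
product of the weights of its parts before, at and after the exit steps. By the exclusion rule the
exit steps start from an admissible configuration, and summation over all `N`-paths from `c₀` to
`c` yields the decomposition of the Green function.

For the total mass, let the particles run one after another until they leave their domains. The
path of the predecessor is finite, so it blocks the next particle only up to some time `T`, and the
domain is bounded on the right at late times. The probability to stay in the domain forever,
as a function of the starting point, is harmonic in the domain and zero outside. After time `T` it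
vanishes, column by column from the right, because an unblocked walker keeps staying at a site with
probability zero; harmonicity transports this backward in time. So every particle has total exit
weight one, whatever the path of its predecessor.
-/

open scoped ENNReal

namespace TASEP

variable {N : ℕ} {B : Set (ℤ × ℤ)} {p : ℝ}

lemma isLowerSet_under (B : Set (ℤ × ℤ)) : IsLowerSet (under B) := by
  rintro z y hyz ⟨b, hb, hx, ht⟩
  exact ⟨b, hb, hyz.1.trans hx, hyz.2.trans ht⟩

lemma mem_of_isLowerSet {L : Set (ℤ × ℤ)} (hL : IsLowerSet L) {x y s t : ℤ} (h : (y, t) ∈ L)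
    (hxy : x ≤ y) (hst : s ≤ t) : (x, s) ∈ L :=
  hL (show (x, s) ≤ (y, t) from ⟨hxy, hst⟩) h

lemma mem_under_NBoundary {i : Fin N} {x t : ℤ} :
    (x, t) ∈ under (NBoundary N B i) ↔ (x + i.val, t) ∈ under B := by
  constructor
  · rintro ⟨_, ⟨b, hb, rfl⟩, hx, ht⟩
    exact ⟨b, hb, by simp only at hx ⊢; omega, ht⟩
  · rintro ⟨b, hb, hx, ht⟩
    exact ⟨_, ⟨b, hb, rfl⟩, by simp only at hx ⊢; omega, ht⟩

lemma mem_under_NBoundary_iff_preceding {i j : Fin N} (hji : j.val + 1 = i.val) {x t : ℤ} :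
    (x, t) ∈ under (NBoundary N B i) ↔ (x + 1, t) ∈ under (NBoundary N B j) := by
  rw [mem_under_NBoundary, mem_under_NBoundary, ← hji, Nat.cast_add, Nat.cast_one,
    add_comm (j.val : ℤ), add_assoc]

lemma IsBoundary.isBoundary_translate (hB : IsBoundary B) (n : ℤ) :
    IsBoundary (translate n B) := by
  obtain ⟨b, rfl, hstep⟩ := hB
  refine ⟨fun k => ((b k).1 + n, (b k).2), Set.range_comp (fun z => (z.1 + n, z.2)) b, fun k => ?_⟩
  rcases hstep k with h | h <;> simp [h, add_right_comm]

lemma IsBoundary.isBoundary_NBoundary (hB : IsBoundary B) (i : Fin N) :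
    IsBoundary (NBoundary N B i) :=
  hB.isBoundary_translate _

lemma IsBoundary.exists_staircase (hB : IsBoundary B) :
    ∃ b : ℤ → ℤ × ℤ, Set.range b = B ∧ (Monotone fun k => (b k).1) ∧
      (Antitone fun k => (b k).2) ∧ ∀ k, (b k).1 - (b k).2 = (b 0).1 - (b 0).2 + k := by
  obtain ⟨b, hb, hstep⟩ := hB
  refine ⟨b, hb, monotone_int_of_le_succ fun k => ?_, antitone_int_of_succ_le fun k => ?_,
    fun k => ?_⟩
  · rcases hstep k with h | h <;> simp [h]
  · rcases hstep k with h | h <;> simp [h]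
  · induction k using Int.induction_on with
    | zero => simp
    | succ k ih => rcases hstep k with h | h <;> simp only [h] <;> omega
    | pred k ih =>
      have hpred := hstep (-k - 1)
      rw [sub_add_cancel] at hpred
      rcases hpred with h | h <;> simp only [h] at ih <;> omega

-- A staircase meets every diagonal `x - t = const` exactly once.
lemma IsBoundary.mem_iff (hB : IsBoundary B) (z : ℤ × ℤ) :
    z ∈ B ↔ z ∈ under B ∧ (z.1 + 1, z.2 + 1) ∉ under B := by
  obtain ⟨b, rfl, hx, ht, hdiag⟩ := hB.exists_staircase
  have not_lt_and_lt (j k : ℤ) : ¬ ((b k).1 < (b j).1 ∧ (b k).2 < (b j).2) := by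
    rintro ⟨hx', ht'⟩
    rcases le_total j k with h | h
    · exact hx'.not_ge (hx h)
    · exact ht'.not_ge (ht h)
  constructor
  · rintro ⟨k, rfl⟩
    refine ⟨⟨_, ⟨k, rfl⟩, le_rfl, le_rfl⟩, ?_⟩
    rintro ⟨_, ⟨j, rfl⟩, hx', ht'⟩
    exact not_lt_and_lt j k ⟨hx', ht'⟩
  · rintro ⟨⟨_, ⟨j, rfl⟩, hxj, htj⟩, hout⟩
    obtain ⟨k, hk⟩ : ∃ k, (b k).1 - (b k).2 = z.1 - z.2 :=
      ⟨z.1 - z.2 - ((b 0).1 - (b 0).2), by rw [hdiag]; ring⟩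
    have hle : (b k).1 ≤ z.1 := by
      by_contra! hlt
      exact hout ⟨_, ⟨k, rfl⟩, hlt, by simp only; omega⟩
    have hge : z.1 ≤ (b k).1 := by
      by_contra! hlt
      exact not_lt_and_lt j k ⟨by omega, by omega⟩
    exact ⟨k, Prod.ext (by omega) (by omega)⟩

lemma IsBoundary.exists_bound (hB : IsBoundary B) :
    ∃ M T : ℤ, ∀ z ∈ under B, T ≤ z.2 → z.1 ≤ M := by
  obtain ⟨b, rfl, hx, ht, -⟩ := hB.exists_staircase
  refine ⟨(b 0).1, (b 0).2 + 1, ?_⟩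
  rintro z ⟨_, ⟨j, rfl⟩, hxj, htj⟩ hT
  have hj : j ≤ 0 := by
    by_contra! hj
    exact absurd (ht hj.le) (by simp only; omega)
  exact hxj.trans (hx hj)

/-- A trajectory `f` that stays or jumps one site to the right at every time. -/
def IsWalk (f : ℤ → ℤ) : Prop :=
  ∀ s, f (s + 1) = f s ∨ f (s + 1) = f s + 1

lemma IsWalk.monotone {f : ℤ → ℤ} (hf : IsWalk f) : Monotone f :=
  monotone_int_of_le_succ fun s => by rcases hf s with h | h <;> omega

/-- The trajectory `f`, followed from time `a` on, is outside of `L` for the first time at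
time `b`. -/
def FirstExit (L : Set (ℤ × ℤ)) (f : ℤ → ℤ) (a b : ℤ) : Prop :=
  a ≤ b ∧ (∀ s, a ≤ s → s < b → (f s, s) ∈ L) ∧ (f b, b) ∉ L

section FirstExit
variable {L : Set (ℤ × ℤ)} {f g : ℤ → ℤ} {a b t : ℤ}

lemma FirstExit.unique (hb : FirstExit L f a b) (ht : FirstExit L f a t) : b = t := by
  by_contra hne
  rcases lt_or_gt_of_ne hne with h | h
  · exact hb.2.2 (ht.2.1 b hb.1 h)
  · exact ht.2.2 (hb.2.1 t ht.1 h)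

lemma FirstExit.congr (h : FirstExit L f a b) (hfg : ∀ s, a ≤ s → s ≤ b → f s = g s) :
    FirstExit L g a b := by
  refine ⟨h.1, fun s has hsb => ?_, ?_⟩
  · rw [← hfg s has hsb.le]
    exact h.2.1 s has hsb
  · rw [← hfg b h.1 le_rfl]
    exact h.2.2

lemma firstExit_congr (hfg : ∀ s, a ≤ s → s ≤ b → f s = g s) :
    FirstExit L f a b ↔ FirstExit L g a b :=
  ⟨fun h => h.congr hfg, fun h => h.congr fun s has hsb => (hfg s has hsb).symm⟩

lemma exists_firstExit_succ (hab : a ≤ b) (ha : (f a, a) ∈ L) (hb : (f b, b) ∉ L) :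
    ∃ t, a ≤ t ∧ t < b ∧ FirstExit L f a (t + 1) := by
  obtain ⟨u, ⟨hau, hu⟩, hmin⟩ := Int.exists_least_of_bdd (P := fun u => a ≤ u ∧ (f u, u) ∉ L)
    ⟨a, fun _ h => h.1⟩ ⟨b, hab, hb⟩
  have hub : u ≤ b := hmin b ⟨hab, hb⟩
  have hne : u ≠ a := fun h => hu (h ▸ ha)
  refine ⟨u - 1, by omega, by omega, ?_⟩
  rw [sub_add_cancel]
  refine ⟨hau, fun s has hsu => ?_, hu⟩
  by_contra hs
  exact hsu.not_ge (hmin s ⟨has, hs⟩)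

lemma FirstExit.notMem_of_le (h : FirstExit L f a b) (hL : IsLowerSet L) (hf : Monotone f)
    (hbt : b ≤ t) : (f t, t) ∉ L :=
  fun ht => h.2.2 (mem_of_isLowerSet hL ht (hf hbt) hbt)

lemma FirstExit.lt_of_mem (h : FirstExit L f a b) (hL : IsLowerSet L) (hf : Monotone f)
    (ht : (f t, t) ∈ L) : t < b :=
  lt_of_not_ge fun hbt => h.notMem_of_le hL hf hbt ht

lemma firstExit_of_isLowerSet (hL : IsLowerSet L) (hf : Monotone f) (hat : a ≤ t)
    (hin : (f t, t) ∈ L) (hout : (f (t + 1), t + 1) ∉ L) : FirstExit L f a (t + 1) :=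
  ⟨by omega, fun s _ hst =>
    have hst' : s ≤ t := by omega
    mem_of_isLowerSet hL hin (hf hst') hst', hout⟩

lemma firstExit_iff_of_mem (hin : (f a, a) ∈ L) :
    FirstExit L f a b ↔ FirstExit L f (a + 1) b := by
  constructor
  · rintro ⟨hab, hmem, hb⟩
    have hne : a ≠ b := fun h => hb (h ▸ hin)
    exact ⟨by omega, fun s hs => hmem s (by omega), hb⟩
  · rintro ⟨hab, hmem, hb⟩
    refine ⟨by omega, fun s has hsb => ?_, hb⟩
    rcases has.eq_or_lt with rfl | hlt
    · exact hin
    · exact hmem s hlt hsb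

lemma FirstExit.mem_boundary (hB : IsBoundary B) (hf : IsWalk f) (hat : a ≤ t)
    (h : FirstExit (under B) f a (t + 1)) : (f t, t) ∈ B := by
  have hstep : f (t + 1) ≤ f t + 1 := by rcases hf t with hs | hs <;> omega
  exact (hB.mem_iff _).2 ⟨h.2.1 t hat (by omega), fun hmem =>
    h.2.2 (mem_of_isLowerSet (isLowerSet_under B) hmem hstep le_rfl)⟩

end FirstExit

lemma mem_precedingPath {c₀ c : Config N} {pos : Fin N → ℤ → ℤ} {i : Fin N} {y s : ℤ} :
    (y, s) ∈ precedingPath c₀ c pos i ↔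
      ∃ j : Fin N, j.val + 1 = i.val ∧ (c₀ j).2 ≤ s ∧ s ≤ (c j).2 ∧ y = pos j s := Iff.rfl

lemma elemWeight_nonneg (hp0 : 0 ≤ p) (hp1 : p ≤ 1) (S : Set (ℤ × ℤ)) (a b : ℤ × ℤ) :
    0 ≤ elemWeight p S a b := by
  unfold elemWeight
  split_ifs <;> linarith

lemma elemWeight_congr {S S' : Set (ℤ × ℤ)} {x t : ℤ} (b : ℤ × ℤ)
    (hS : (x + 1, t + 1) ∈ S ↔ (x + 1, t + 1) ∈ S') :
    elemWeight p S (x, t) b = elemWeight p S' (x, t) b := by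
  unfold elemWeight
  by_cases hmem : (x + 1, t + 1) ∈ S
  · simp only [if_pos hmem, if_pos (hS.1 hmem)]
  · simp only [if_neg hmem, if_neg (mt hS.2 hmem)]

lemma step_of_elemWeight_ne_zero {S : Set (ℤ × ℤ)} {x y t : ℤ}
    (h : elemWeight p S (x, t) (y, t + 1) ≠ 0) :
    y = x ∨ y = x + 1 ∧ (x + 1, t + 1) ∉ S := by
  contrapose! h
  by_cases hy : y = x + 1
  · simp [elemWeight, hy, h.2 hy]
  · simp [elemWeight, hy, h.1]

lemma pathWeight_nonneg (hp0 : 0 ≤ p) (hp1 : p ≤ 1) (c₀ c : Config N) (pos : Fin N → ℤ → ℤ) :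
    0 ≤ pathWeight p c₀ c pos :=
  Finset.prod_nonneg fun _ _ => Finset.prod_nonneg fun _ _ => elemWeight_nonneg hp0 hp1 _ _ _

lemma pathWeight_congr {c₀ c : Config N} {pos pos' : Fin N → ℤ → ℤ}
    (h : ∀ i s, (c₀ i).2 ≤ s → s ≤ (c i).2 → pos i s = pos' i s) :
    pathWeight p c₀ c pos = pathWeight p c₀ c pos' := by
  refine Finset.prod_congr rfl fun i _ => Finset.prod_congr rfl fun s hs => ?_
  rw [Finset.mem_Ico] at hs
  rw [h i s hs.1 hs.2.le, h i (s + 1) (by omega) (by omega)]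
  refine elemWeight_congr _ ?_
  simp only [mem_precedingPath]
  refine exists_congr fun j => and_congr_right fun _ => and_congr_right fun h0 =>
    and_congr_right fun h1 => ?_
  rw [h j _ h0 h1]

lemma pathWeight_self (c : Config N) (pos : Fin N → ℤ → ℤ) : pathWeight p c c pos = 1 := by
  simp [pathWeight]

lemma step_of_pathWeight_ne_zero {c₀ c : Config N} {pos : Fin N → ℤ → ℤ}
    (h : pathWeight p c₀ c pos ≠ 0) {i : Fin N} {s : ℤ} (h0 : (c₀ i).2 ≤ s) (h1 : s < (c i).2) :
    pos i (s + 1) = pos i s ∨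
      pos i (s + 1) = pos i s + 1 ∧ (pos i s + 1, s + 1) ∉ precedingPath c₀ c pos i :=
  step_of_elemWeight_ne_zero <| Finset.prod_ne_zero_iff.1
    (Finset.prod_ne_zero_iff.1 h i (Finset.mem_univ _)) s (Finset.mem_Ico.2 ⟨h0, h1⟩)

namespace NPath
variable {c₀ c : Config N}

lemma ext {π ρ : NPath c₀ c} (h : π.pos = ρ.pos) : π = ρ := by
  cases π
  cases ρ
  cases h
  rfl

lemma pos_start_time (π : NPath c₀ c) (i : Fin N) : π.pos i (c₀ i).2 = (c₀ i).1 :=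
  π.pos_start i _ le_rfl

lemma pos_end_time (π : NPath c₀ c) (i : Fin N) : π.pos i (c i).2 = (c i).1 :=
  π.pos_end i _ le_rfl

lemma isWalk (π : NPath c₀ c) (h : pathWeight p c₀ c π.pos ≠ 0) (i : Fin N) :
    IsWalk (π.pos i) := by
  intro s
  rcases lt_or_ge s (c₀ i).2 with h0 | h0
  · left
    rw [π.pos_start i s h0.le, π.pos_start i (s + 1) h0]
  · rcases lt_or_ge s (c i).2 with h1 | h1
    · exact (step_of_pathWeight_ne_zero h h0 h1).imp_right And.left
    · left
      rw [π.pos_end i s h1, π.pos_end i (s + 1) (by omega)]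

lemma pos_lt_preceding (hc₀ : Admissible c₀) (π : NPath c₀ c) (h : pathWeight p c₀ c π.pos ≠ 0)
    {i j : Fin N} (hji : j.val + 1 = i.val) {s : ℤ} (h0 : (c₀ i).2 ≤ s) (h1 : s ≤ (c j).2) :
    π.pos i s < π.pos j s := by
  have hlt : j < i := Fin.lt_def.2 (by omega)
  have hmono : Monotone (π.pos j) := (π.isWalk h j).monotone
  have htime : (c₀ j).2 ≤ (c₀ i).2 := hc₀.2 hlt.le
  induction s, h0 using Int.leInduction with
  | base =>
    calc π.pos i (c₀ i).2 = (c₀ i).1 := π.pos_start_time i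
      _ < (c₀ j).1 := hc₀.1 hlt
      _ = π.pos j (c₀ j).2 := (π.pos_start_time j).symm
      _ ≤ π.pos j (c₀ i).2 := hmono htime
  | succ s h0 ih =>
    have hs : π.pos i s < π.pos j s := ih (by omega)
    have hjs : π.pos j s ≤ π.pos j (s + 1) := hmono (by omega)
    rcases lt_or_ge s (c i).2 with h2 | h2
    · rcases step_of_pathWeight_ne_zero h h0 h2 with hstay | ⟨hjump, hfree⟩
      · omega
      · have hne : π.pos i s + 1 ≠ π.pos j (s + 1) := fun heq =>
          hfree (mem_precedingPath.2 ⟨j, hji, by omega, h1, heq⟩)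
        omega
    · rw [π.pos_end i (s + 1) (by omega), ← π.pos_end i s h2]
      omega

end NPath

lemma admissible_of_preceding {c : Config N}
    (h : ∀ i j : Fin N, j.val + 1 = i.val → (c i).1 < (c j).1 ∧ (c j).2 ≤ (c i).2) :
    Admissible c := by
  rcases N with _ | n
  · exact ⟨fun i => i.elim0, fun i => i.elim0⟩
  · exact ⟨Fin.strictAnti_iff_succ_lt.2 fun i => (h _ _ (by simp)).1,
      Fin.monotone_iff_le_succ.2 fun i => (h _ _ (by simp)).2⟩

section exit
variable {c₀ c : Config N}

lemma NPath.exit_time_le (hc₀ : Admissible c₀) (π : NPath c₀ c)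
    (h : pathWeight p c₀ c π.pos ≠ 0) {t : Fin N → ℤ} (h0 : ∀ i, (c₀ i).2 ≤ t i)
    (h1 : ∀ i, t i < (c i).2)
    (hexit : ∀ i, FirstExit (under (NBoundary N B i)) (π.pos i) (c₀ i).2 (t i + 1))
    {i j : Fin N} (hji : j.val + 1 = i.val) : t j ≤ t i := by
  by_contra! hlt
  have hpos : π.pos i (t i + 1) < π.pos j (t i + 1) :=
    π.pos_lt_preceding hc₀ h hji ((h0 i).trans (by omega)) (hlt.trans (h1 j))
  have hin : (π.pos j (t j), t j) ∈ under (NBoundary N B j) := (hexit j).2.1 _ (h0 j) (by omega)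
  refine (hexit i).2.2 ((mem_under_NBoundary_iff_preceding hji).2 ?_)
  exact mem_of_isLowerSet (isLowerSet_under _) hin
    ((Int.add_one_le_iff.2 hpos).trans ((π.isWalk h j).monotone hlt)) hlt

lemma NPath.admissible_exit (hc₀ : Admissible c₀) (π : NPath c₀ c)
    (h : pathWeight p c₀ c π.pos ≠ 0) {t : Fin N → ℤ} (h0 : ∀ i, (c₀ i).2 ≤ t i)
    (h1 : ∀ i, t i < (c i).2)
    (hexit : ∀ i, FirstExit (under (NBoundary N B i)) (π.pos i) (c₀ i).2 (t i + 1)) :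
    Admissible fun i => (π.pos i (t i), t i) := by
  refine admissible_of_preceding fun i j hji => ?_
  have hle : t j ≤ t i := π.exit_time_le hc₀ h h0 h1 hexit hji
  refine ⟨?_, hle⟩
  rcases hle.eq_or_lt with heq | hlt
  · simp only [heq]
    exact π.pos_lt_preceding hc₀ h hji (h0 i) (heq ▸ (h1 j).le)
  · by_contra! hge
    have hstep : π.pos j (t j + 1) ≤ π.pos i (t i) + 1 := by
      rcases π.isWalk h j (t j) with hs | hs <;> simp only at hge <;> omega
    have hin : (π.pos i (t i), t i) ∈ under (NBoundary N B i) := (hexit i).2.1 _ (h0 i) (by omega)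
    exact (hexit j).2.2 (mem_of_isLowerSet (isLowerSet_under _)
      ((mem_under_NBoundary_iff_preceding hji).1 hin) hstep hlt)

lemma mem_pathPoints_left_iff {c' c'' : Config N} {pos : Fin N → ℤ → ℤ} {j : Fin N}
    {L : Set (ℤ × ℤ)} (hL : IsLowerSet L) (hmono : Monotone (pos j)) (h1 : (c'' j).2 ≤ (c j).2)
    (hnext : (c'' j).2 = (c' j).2 + 1) (hexit : FirstExit L (pos j) (c₀ j).2 (c'' j).2)
    {x s : ℤ} (hx : (x, s) ∈ L) :
    (x, s) ∈ pathPoints c₀ c pos j ↔ (x, s) ∈ pathPoints c₀ c' pos j := by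
  refine and_congr_right fun _ => and_congr_left fun hpos => ⟨fun _ => ?_, fun hs => ?_⟩
  · have hlt : s < (c'' j).2 := hexit.lt_of_mem hL hmono (by simpa only [← hpos] using hx)
    simp only
    omega
  · simp only at hs ⊢
    omega

/-- Applied with the exit step of the particle after the `j`-th one: the domain of the `j`-th
particle lies one site further to the right, so its path can block this step only with its own
exit step. -/
lemma mem_pathPoints_exit_iff {c' c'' : Config N} {pos : Fin N → ℤ → ℤ} {j : Fin N}
    {L : Set (ℤ × ℤ)} (hL : IsLowerSet L) (hmono : Monotone (pos j)) (h0 : (c₀ j).2 ≤ (c' j).2)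
    (h1 : (c'' j).2 ≤ (c j).2) (hnext : (c'' j).2 = (c' j).2 + 1)
    (hexit : FirstExit L (pos j) (c₀ j).2 (c'' j).2) {x s : ℤ} (hs : (c' j).2 ≤ s)
    (hx : (x, s) ∈ L) :
    (x, s + 1) ∈ pathPoints c₀ c pos j ↔ (x, s + 1) ∈ pathPoints c' c'' pos j := by
  refine ⟨fun ⟨_, _, hpos⟩ => ⟨by simp only; omega, ?_, hpos⟩,
    fun ⟨_, h, hpos⟩ => ⟨by simp only; omega, h.trans h1, hpos⟩⟩
  have hlt : s < (c'' j).2 := by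
    refine hexit.lt_of_mem hL hmono (mem_of_isLowerSet hL hx ?_ le_rfl)
    calc pos j s ≤ pos j (s + 1) := hmono (by omega)
      _ = x := hpos.symm
  exact hlt

lemma mem_pathPoints_right_iff {c'' : Config N} {pos : Fin N → ℤ → ℤ} {j : Fin N}
    (h0 : (c₀ j).2 ≤ (c'' j).2) {z : ℤ × ℤ} (hz : (c'' j).2 ≤ z.2) :
    z ∈ pathPoints c₀ c pos j ↔ z ∈ pathPoints c'' c pos j :=
  ⟨fun ⟨_, h⟩ => ⟨hz, h⟩, fun ⟨_, h⟩ => ⟨h0.trans hz, h⟩⟩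

lemma prod_Ico_mul_prod_Ico {α M : Type*} [LinearOrder α] [LocallyFiniteOrder α] [CommMonoid M]
    (f : α → M) {a b c : α} (hab : a ≤ b) (hbc : b ≤ c) :
    (∏ s ∈ Finset.Ico a b, f s) * ∏ s ∈ Finset.Ico b c, f s = ∏ s ∈ Finset.Ico a c, f s := by
  rw [← Finset.prod_union (Finset.Ico_disjoint_Ico_consecutive _ _ _),
    Finset.Ico_union_Ico_eq_Ico hab hbc]

theorem pathWeight_eq_mul_of_firstExit {c' c'' : Config N} {pos : Fin N → ℤ → ℤ}
    (hmono : ∀ i, Monotone (pos i)) (h0 : ∀ i, (c₀ i).2 ≤ (c' i).2)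
    (h1 : ∀ i, (c'' i).2 ≤ (c i).2) (hnext : ∀ i, (c'' i).2 = (c' i).2 + 1)
    (hexit : ∀ i, FirstExit (under (NBoundary N B i)) (pos i) (c₀ i).2 (c'' i).2)
    (htime : Monotone fun i => (c' i).2) :
    pathWeight p c₀ c pos =
      pathWeight p c₀ c' pos * pathWeight p c' c'' pos * pathWeight p c'' c pos := by
  simp only [pathWeight, ← Finset.prod_mul_distrib]
  refine Finset.prod_congr rfl fun i _ => ?_
  have h01 : (c' i).2 ≤ (c'' i).2 := by have := hnext i; omega
  rw [← prod_Ico_mul_prod_Ico _ ((h0 i).trans h01) (h1 i), ← prod_Ico_mul_prod_Ico _ (h0 i) h01]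
  have hlower (j : Fin N) := isLowerSet_under (NBoundary N B j)
  have hin : (pos i (c' i).2, (c' i).2) ∈ under (NBoundary N B i) :=
    (hexit i).2.1 _ (h0 i) (by have := hnext i; omega)
  congr 1
  · congr 1
    · refine Finset.prod_congr rfl fun s hs => elemWeight_congr _ <| exists_congr fun j =>
        and_congr_right fun hji => ?_
      rw [Finset.mem_Ico] at hs
      refine mem_pathPoints_left_iff (hlower j) (hmono j) (h1 j) (hnext j) (hexit j) ?_
      rw [← mem_under_NBoundary_iff_preceding hji]
      exact mem_of_isLowerSet (hlower i) hin (hmono i hs.2.le) hs.2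
    · refine Finset.prod_congr rfl fun s hs => elemWeight_congr _ <| exists_congr fun j =>
        and_congr_right fun hji => ?_
      obtain rfl : s = (c' i).2 := by
        rw [Finset.mem_Ico, hnext] at hs
        omega
      exact mem_pathPoints_exit_iff (hlower j) (hmono j) (h0 j) (h1 j) (hnext j) (hexit j)
        (htime (Fin.le_def.2 (by omega))) ((mem_under_NBoundary_iff_preceding hji).1 hin)
  · refine Finset.prod_congr rfl fun s hs => elemWeight_congr _ <| exists_congr fun j =>
      and_congr_right fun hji => mem_pathPoints_right_iff (hexit j).1 ?_
    have hji' : (c' j).2 ≤ (c' i).2 := htime (Fin.le_def.2 (by omega))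
    have := hnext i
    have := hnext j
    rw [Finset.mem_Ico] at hs
    simp only
    omega

end exit

namespace NPath
variable {c₀ c' c'' c : Config N}

/-- The `N`-path from `c₀` to `c` whose positions in the time windows are given by `pos`. -/
def ofPos (pos : Fin N → ℤ → ℤ) (htime : ∀ i, (c₀ i).2 ≤ (c i).2)
    (hstart : ∀ i, pos i (c₀ i).2 = (c₀ i).1) (hend : ∀ i, pos i (c i).2 = (c i).1) :
    NPath c₀ c where
  pos i s := pos i (max (c₀ i).2 (min s (c i).2))
  time_le := htime
  pos_start i s hs := by rw [max_eq_left ((min_le_left _ _).trans hs), hstart]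
  pos_end i s hs := by rw [min_eq_right hs, max_eq_right (htime i), hend]

lemma ofPos_pos {pos : Fin N → ℤ → ℤ} {htime : ∀ i, (c₀ i).2 ≤ (c i).2}
    {hstart : ∀ i, pos i (c₀ i).2 = (c₀ i).1} {hend : ∀ i, pos i (c i).2 = (c i).1} {i : Fin N}
    {s : ℤ} (h0 : (c₀ i).2 ≤ s) (h1 : s ≤ (c i).2) :
    (ofPos pos htime hstart hend).pos i s = pos i s := by
  simp only [ofPos, min_eq_left h1, max_eq_right h0]

/-- The concatenation of two `N`-paths and the single steps between them. -/
def glue (hnext : ∀ i, (c'' i).2 = (c' i).2 + 1) (π : NPath c₀ c') (ρ : NPath c'' c) :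
    NPath c₀ c where
  pos i s := if s ≤ (c' i).2 then π.pos i s else ρ.pos i s
  time_le i := by
    have := π.time_le i
    have := ρ.time_le i
    have := hnext i
    omega
  pos_start i s hs := by rw [if_pos (hs.trans (π.time_le i)), π.pos_start i s hs]
  pos_end i s hs := by
    have := ρ.time_le i
    have := hnext i
    rw [if_neg (by omega), ρ.pos_end i s hs]

section glue
variable (hnext : ∀ i, (c'' i).2 = (c' i).2 + 1) (π : NPath c₀ c') (ρ : NPath c'' c)

lemma glue_pos_of_le {i : Fin N} {s : ℤ} (hs : s ≤ (c' i).2) :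
    (π.glue hnext ρ).pos i s = π.pos i s := if_pos hs

lemma glue_pos_of_lt {i : Fin N} {s : ℤ} (hs : (c' i).2 < s) :
    (π.glue hnext ρ).pos i s = ρ.pos i s := if_neg hs.not_ge

lemma glue_pos_left (i : Fin N) : (π.glue hnext ρ).pos i (c' i).2 = (c' i).1 :=
  (glue_pos_of_le hnext π ρ le_rfl).trans (π.pos_end_time i)

lemma glue_pos_right (i : Fin N) : (π.glue hnext ρ).pos i (c'' i).2 = (c'' i).1 :=
  (glue_pos_of_lt hnext π ρ (by have := hnext i; omega)).trans (ρ.pos_start_time i)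

lemma isWalk_glue (hπ : pathWeight p c₀ c' π.pos ≠ 0) (hρ : pathWeight p c'' c ρ.pos ≠ 0)
    (hstep : stepWeight p c' c'' ≠ 0) (i : Fin N) : IsWalk ((π.glue hnext ρ).pos i) := by
  intro s
  rcases lt_trichotomy s (c' i).2 with h | rfl | h
  · rw [glue_pos_of_le hnext π ρ h, glue_pos_of_le hnext π ρ h.le]
    exact π.isWalk hπ i s
  · rw [glue_pos_left, ← hnext, glue_pos_right]
    have hs := step_of_pathWeight_ne_zero hstep (i := i) le_rfl (by rw [hnext]; omega)
    simpa using hs.imp_right And.left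
  · rw [glue_pos_of_lt hnext π ρ (by omega), glue_pos_of_lt hnext π ρ h]
    exact ρ.isWalk hρ i s

lemma firstExit_glue (hin : ∀ i, c' i ∈ under (NBoundary N B i))
    (hout : ∀ i, c'' i ∉ under (NBoundary N B i)) (i : Fin N)
    (hmono : Monotone ((π.glue hnext ρ).pos i)) :
    FirstExit (under (NBoundary N B i)) ((π.glue hnext ρ).pos i) (c₀ i).2 (c'' i).2 := by
  rw [hnext]
  refine firstExit_of_isLowerSet (isLowerSet_under _) hmono (π.time_le i) ?_ ?_
  · rw [glue_pos_left]
    exact hin i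
  · rw [← hnext, glue_pos_right]
    exact hout i

lemma pathWeight_glue_left :
    pathWeight p c₀ c' (π.glue hnext ρ).pos = pathWeight p c₀ c' π.pos :=
  pathWeight_congr fun _ _ _ hs => glue_pos_of_le hnext π ρ hs

lemma pathWeight_glue_right :
    pathWeight p c'' c (π.glue hnext ρ).pos = pathWeight p c'' c ρ.pos :=
  pathWeight_congr fun i _ hs _ => glue_pos_of_lt hnext π ρ (by have := hnext i; omega)

lemma pathWeight_glue_step : pathWeight p c' c'' (π.glue hnext ρ).pos = stepWeight p c' c'' := by
  refine pathWeight_congr fun i s hs hs' => ?_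
  rcases hs.eq_or_lt with rfl | hlt
  · rw [glue_pos_left, if_pos le_rfl]
  · obtain rfl : s = (c'' i).2 := by have := hnext i; omega
    rw [glue_pos_right, if_neg hlt.not_ge]

lemma pathWeight_glue (htime : Monotone fun i => (c' i).2)
    (hin : ∀ i, c' i ∈ under (NBoundary N B i)) (hout : ∀ i, c'' i ∉ under (NBoundary N B i)) :
    pathWeight p c₀ c (π.glue hnext ρ).pos =
      pathWeight p c₀ c' π.pos * stepWeight p c' c'' * pathWeight p c'' c ρ.pos := by
  by_cases hwalk : ∀ i, IsWalk ((π.glue hnext ρ).pos i)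
  · have hmono (i : Fin N) := (hwalk i).monotone
    rw [pathWeight_eq_mul_of_firstExit hmono π.time_le ρ.time_le hnext
      (fun i => firstExit_glue hnext π ρ hin hout i (hmono i)) htime,
      pathWeight_glue_left, pathWeight_glue_step, pathWeight_glue_right]
  · have hglue : pathWeight p c₀ c (π.glue hnext ρ).pos = 0 := by
      contrapose! hwalk
      exact (π.glue hnext ρ).isWalk hwalk
    rw [hglue, eq_comm]
    contrapose! hwalk
    exact isWalk_glue hnext π ρ (left_ne_zero_of_mul (left_ne_zero_of_mul hwalk))
      (right_ne_zero_of_mul hwalk) (right_ne_zero_of_mul (left_ne_zero_of_mul hwalk))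

end glue

end NPath

lemma BoundaryConfig.mem_under (hB : IsBoundary B) (c : BoundaryConfig N B) (i : Fin N) :
    c.1 i ∈ under (NBoundary N B i) :=
  (((hB.isBoundary_NBoundary i).mem_iff _).1 (c.2.2 i)).1

lemma ExitTarget.time_eq {c' : Config N} (c'' : ExitTarget B c') (i : Fin N) :
    (c''.1 i).2 = (c' i).2 + 1 := (c''.2 i).1

/-- The `N`-tuples of steps that start from an admissible configuration on the `N`-boundary and
leave the domains. -/
abbrev ExitStep (N : ℕ) (B : Set (ℤ × ℤ)) : Type :=
  (c : BoundaryConfig N B) × ExitTarget B c.1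

/-- The `N`-paths from `c₀` to `c` that are cut into an `N`-path to the boundary, exit steps, and
an `N`-path to `c`. -/
abbrev SplitPath (B : Set (ℤ × ℤ)) (c₀ c : Config N) : Type :=
  (e : ExitStep N B) × NPath c₀ e.1.1 × NPath e.2.1 c

namespace SplitPath
variable {c₀ c : Config N}

/-- The `N`-path that is put together from the pieces. -/
def glue (x : SplitPath B c₀ c) : NPath c₀ c :=
  NPath.glue x.1.2.time_eq x.2.1 x.2.2

/-- The product of the weights of the three pieces. -/
noncomputable def weight (p : ℝ) (x : SplitPath B c₀ c) : ℝ :=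
  pathWeight p c₀ x.1.1.1 x.2.1.pos * stepWeight p x.1.1.1 x.1.2.1 *
    pathWeight p x.1.2.1 c x.2.2.pos

lemma pathWeight_glue (hB : IsBoundary B) (x : SplitPath B c₀ c) :
    pathWeight p c₀ c x.glue.pos = x.weight p :=
  NPath.pathWeight_glue x.1.2.time_eq x.2.1 x.2.2 x.1.1.2.1.2 (x.1.1.mem_under hB)
    fun i => (x.1.2.2 i).2

lemma firstExit_glue (hB : IsBoundary B) (x : SplitPath B c₀ c) (hx : x.weight p ≠ 0)
    (i : Fin N) :
    FirstExit (under (NBoundary N B i)) (x.glue.pos i) (c₀ i).2 (x.1.2.1 i).2 := by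
  rw [← x.pathWeight_glue hB] at hx
  exact NPath.firstExit_glue x.1.2.time_eq x.2.1 x.2.2 (x.1.1.mem_under hB)
    (fun i => (x.1.2.2 i).2) i (x.glue.isWalk hx i).monotone

lemma eq_of_glue_eq {x y : SplitPath B c₀ c} (h : x.glue = y.glue)
    (htime : ∀ i, (x.1.2.1 i).2 = (y.1.2.1 i).2) : x = y := by
  obtain ⟨⟨⟨c', hc'⟩, ⟨c'', hc''⟩⟩, π, ρ⟩ := x
  obtain ⟨⟨⟨d', hd'⟩, ⟨d'', hd''⟩⟩, σ, τ⟩ := y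
  simp only at htime
  have hcnext (i) : (c'' i).2 = (c' i).2 + 1 := (hc'' i).1
  have hdnext (i) : (d'' i).2 = (d' i).2 + 1 := (hd'' i).1
  have hpos (i s) : (π.glue hcnext ρ).pos i s =
      (σ.glue hdnext τ).pos i s := congrArg (fun κ => κ.pos i s) h
  have htime' (i) : (c' i).2 = (d' i).2 := by
    have := htime i
    rw [hcnext, hdnext] at this
    omega
  obtain rfl : c' = d' := funext fun i => Prod.ext
    (by have := hpos i (c' i).2
        rwa [NPath.glue_pos_left, htime', NPath.glue_pos_left] at this) (htime' i)
  obtain rfl : c'' = d'' := funext fun i => Prod.ext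
    (by have := hpos i (c'' i).2
        rwa [NPath.glue_pos_right, htime, NPath.glue_pos_right] at this) (htime i)
  obtain rfl : π = σ := NPath.ext <| funext₂ fun i s => by
    rcases le_total s (c' i).2 with hs | hs
    · simpa only [NPath.glue_pos_of_le _ _ _ hs] using hpos i s
    · rw [π.pos_end i s hs, σ.pos_end i s hs]
  obtain rfl : ρ = τ := NPath.ext <| funext₂ fun i s => by
    rcases le_or_gt s (c' i).2 with hs | hs
    · have hs' : s ≤ (c'' i).2 := by have := hcnext i; omega
      rw [ρ.pos_start i s hs', τ.pos_start i s hs']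
    · simpa only [NPath.glue_pos_of_lt _ _ _ hs] using hpos i s
  rfl

lemma injOn_glue (hB : IsBoundary B) :
    Set.InjOn glue {x : SplitPath B c₀ c | x.weight p ≠ 0} := by
  intro x hx y hy h
  refine eq_of_glue_eq h fun i => (x.firstExit_glue hB hx i).unique ?_
  rw [h]
  exact y.firstExit_glue hB hy i

lemma exists_glue_eq (hB : IsBoundary B) (hc₀ : Admissible c₀)
    (hc₀B : ∀ i, c₀ i ∈ under (NBoundary N B i)) (hc : ∀ i, c i ∉ under (NBoundary N B i))
    (π : NPath c₀ c) (hπ : pathWeight p c₀ c π.pos ≠ 0) : ∃ x : SplitPath B c₀ c, x.glue = π := by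
  choose t h0 h1 hexit using fun i => exists_firstExit_succ (f := π.pos i) (π.time_le i)
    (by rw [π.pos_start_time]; exact hc₀B i) (by rw [π.pos_end_time]; exact hc i)
  let c' : BoundaryConfig N B := ⟨fun i => (π.pos i (t i), t i),
    π.admissible_exit hc₀ hπ h0 h1 hexit, fun i =>
      (hexit i).mem_boundary (hB.isBoundary_NBoundary i) (π.isWalk hπ i) (h0 i)⟩
  let c'' : ExitTarget B c'.1 := ⟨fun i => (π.pos i (t i + 1), t i + 1),
    fun i => ⟨rfl, (hexit i).2.2⟩⟩
  let ρ : NPath c₀ c'.1 := .ofPos π.pos h0 π.pos_start_time fun _ => rfl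
  let σ : NPath c''.1 c := .ofPos π.pos h1 (fun _ => rfl) π.pos_end_time
  refine ⟨⟨⟨c', c''⟩, ρ, σ⟩, NPath.ext <| funext₂ fun i s => ?_⟩
  rcases le_or_gt s (t i) with hs | hs
  · refine (NPath.glue_pos_of_le _ ρ σ hs).trans ?_
    rcases le_total (c₀ i).2 s with hs0 | hs0
    · exact NPath.ofPos_pos hs0 hs
    · rw [ρ.pos_start i s hs0, π.pos_start i s hs0]
  · refine (NPath.glue_pos_of_lt _ ρ σ hs).trans ?_
    rcases le_total s (c i).2 with hs1 | hs1
    · exact NPath.ofPos_pos hs hs1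
    · rw [σ.pos_end i s hs1, π.pos_end i s hs1]

end SplitPath

lemma finite_support_pathWeight (c₀ c : Config N) :
    (Function.support fun π : NPath c₀ c => pathWeight p c₀ c π.pos).Finite := by
  refine Set.Finite.of_injOn
    (f := fun π (i : Fin N) (s : Set.Icc (c₀ i).2 (c i).2) => π.pos i s)
    (t := {f | ∀ i s, f i s ∈ Set.Icc (c₀ i).1 (c i).1}) ?_ ?_
    (Set.Finite.pi' fun i => Set.Finite.pi' fun s => Set.finite_Icc _ _)
  · rintro π hπ i ⟨s, hs⟩
    have hmono : Monotone (π.pos i) := (π.isWalk hπ i).monotone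
    rw [← π.pos_start_time, ← π.pos_end_time]
    exact ⟨hmono hs.1, hmono hs.2⟩
  · refine fun π _ ρ _ h => NPath.ext <| funext₂ fun i s => ?_
    rcases le_total s (c₀ i).2 with h0 | h0
    · rw [π.pos_start i s h0, ρ.pos_start i s h0]
    rcases le_total (c i).2 s with h1 | h1
    · rw [π.pos_end i s h1, ρ.pos_end i s h1]
    · exact congrFun (congrFun h i) ⟨s, h0, h1⟩

lemma finite_support_stepWeight (B : Set (ℤ × ℤ)) (c' : Config N) :
    (Function.support fun c'' : ExitTarget B c' => stepWeight p c' c''.1).Finite := by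
  refine Set.Finite.of_injOn (f := fun c'' => c''.1)
    (t := {f | ∀ i, f i ∈ ({((c' i).1, (c' i).2 + 1), ((c' i).1 + 1, (c' i).2 + 1)} : Set _)})
    ?_ Subtype.val_injective.injOn (Set.Finite.pi' fun i => Set.toFinite _)
  intro c'' h i
  have htime := c''.time_eq i
  have hstep := step_of_pathWeight_ne_zero (Function.mem_support.1 h) (i := i) le_rfl
    (by omega)
  have hsite : (c''.1 i).1 = (c' i).1 ∨ (c''.1 i).1 = (c' i).1 + 1 := by
    simpa using hstep.imp_right And.left
  exact hsite.imp (fun h => Prod.ext h htime) fun h => Prod.ext h htime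

lemma summable_pathWeight (c₀ c : Config N) :
    Summable fun π : NPath c₀ c => pathWeight p c₀ c π.pos :=
  summable_of_hasFiniteSupport (finite_support_pathWeight c₀ c)

lemma SplitPath.hasSum_weight (hB : IsBoundary B) {c₀ c : Config N} (hc₀ : Admissible c₀)
    (hc₀B : ∀ i, c₀ i ∈ under (NBoundary N B i)) (hc : ∀ i, c i ∉ under (NBoundary N B i)) :
    HasSum (fun x : SplitPath B c₀ c => x.weight p) (GGF p c c₀) := by
  refine (hasSum_iff_hasSum_of_ne_zero_bij (fun x => x.1.glue)
    (fun x y h => Subtype.ext (SplitPath.injOn_glue hB x.2 y.2 h)) (fun π hπ => ?_)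
    fun x => x.1.pathWeight_glue hB).1 (summable_pathWeight c₀ c).hasSum
  obtain ⟨x, rfl⟩ := SplitPath.exists_glue_eq hB hc₀ hc₀B hc π hπ
  exact ⟨⟨x, by rwa [Function.mem_support, x.pathWeight_glue hB] at hπ⟩, rfl⟩

lemma SplitPath.hasSum_weight_exitStep (c₀ c : Config N) (e : ExitStep N B) :
    HasSum (fun x : NPath c₀ e.1.1 × NPath e.2.1 c => SplitPath.weight p ⟨e, x⟩)
      (GGF p c e.2.1 * stepWeight p e.1.1 e.2.1 * GGF p e.1.1 c₀) := by
  have hprod := summable_mul_of_summable_norm (summable_pathWeight (p := p) c₀ e.1.1).norm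
    (summable_pathWeight (p := p) e.2.1 c).norm
  have h := ((summable_pathWeight c₀ e.1.1).hasSum.mul (summable_pathWeight e.2.1 c).hasSum
    hprod).mul_left (stepWeight p e.1.1 e.2.1)
  have hvalue : GGF p c e.2.1 * stepWeight p e.1.1 e.2.1 * GGF p e.1.1 c₀ =
      stepWeight p e.1.1 e.2.1 * (GGF p e.1.1 c₀ * GGF p c e.2.1) := by ring
  rw [hvalue]
  refine h.congr_fun fun x => ?_
  simp only [SplitPath.weight]
  ring

theorem hasSum_GGF_mul_stepWeight_mul_GGF (hB : IsBoundary B) {c₀ c : Config N}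
    (hc₀ : Admissible c₀) (hc₀B : ∀ i, c₀ i ∈ under (NBoundary N B i))
    (hc : ∀ i, c i ∉ under (NBoundary N B i)) :
    HasSum (fun e : ExitStep N B =>
      GGF p c e.2.1 * stepWeight p e.1.1 e.2.1 * GGF p e.1.1 c₀) (GGF p c c₀) :=
  (SplitPath.hasSum_weight hB hc₀ hc₀B hc).sigma fun e => SplitPath.hasSum_weight_exitStep c₀ c e

lemma tsum_list {α : Type*} (f : List α → ℝ≥0∞) :
    ∑' l, f l = f [] + ∑' (a : α) (l : List α), f (a :: l) := by
  let e : Unit ⊕ α × List α ≃ List α :=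
    { toFun := Sum.elim (fun _ => []) fun x => x.1 :: x.2
      invFun := fun
        | [] => Sum.inl ()
        | a :: l => Sum.inr (a, l)
      left_inv := by rintro (_ | ⟨a, l⟩) <;> rfl
      right_inv := by rintro (_ | ⟨a, l⟩) <;> rfl }
  rw [← e.tsum_eq, Summable.tsum_sum ENNReal.summable ENNReal.summable, ENNReal.tsum_prod',
    tsum_fintype, Fintype.sum_unique]
  rfl

/-- The point after a step from `z`, which is a jump if `b` is true. -/
def nextPoint (z : ℤ × ℤ) (b : Bool) : ℤ × ℤ := (z.1 + if b then 1 else 0, z.2 + 1)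

/-- The positions of a walker who starts at `z` and whose steps are given by the word `l`, extended
by constants. -/
def walk : ℤ × ℤ → List Bool → ℤ → ℤ
  | z, [], _ => z.1
  | z, b :: l, s => if s ≤ z.2 then z.1 else walk (nextPoint z b) l s

section walk
variable {z : ℤ × ℤ} {b : Bool} {l l' : List Bool} {s : ℤ}

lemma walk_of_le (h : s ≤ z.2) : walk z l s = z.1 := by
  cases l with
  | nil => rfl
  | cons b l => exact if_pos h

lemma walk_cons_of_lt (h : z.2 < s) : walk z (b :: l) s = walk (nextPoint z b) l s :=
  if_neg h.not_ge

lemma walk_cons_next : walk z (b :: l) (z.2 + 1) = (nextPoint z b).1 :=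
  (walk_cons_of_lt (by omega)).trans (walk_of_le le_rfl)

lemma endTime_cons (z : ℤ × ℤ) (b : Bool) (l : List Bool) :
    z.2 + ((b :: l).length : ℤ) = (nextPoint z b).2 + l.length := by
  simp only [nextPoint, List.length_cons, Nat.cast_add, Nat.cast_one]
  ring

lemma walk_of_ge (h : z.2 + l.length ≤ s) : walk z l s = walk z l (z.2 + l.length) := by
  induction l generalizing z with
  | nil => rfl
  | cons b l ih =>
    rw [endTime_cons] at h ⊢
    have hlt : z.2 < (nextPoint z b).2 + l.length := by simp only [nextPoint]; omega
    rw [walk_cons_of_lt hlt, walk_cons_of_lt (hlt.trans_le h), ih h]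

lemma eq_of_walk_eq (hlen : l.length = l'.length) (h : walk z l = walk z l') : l = l' := by
  induction l generalizing z l' with
  | nil => exact (List.length_eq_zero_iff.1 hlen.symm).symm
  | cons b l ih =>
    obtain _ | ⟨b', l'⟩ := l'
    · simp at hlen
    obtain rfl : b = b' := by
      have hnext := congrFun h (z.2 + 1)
      rw [walk_cons_next, walk_cons_next] at hnext
      revert hnext
      cases b <;> cases b' <;> simp [nextPoint]
    rw [ih (z := nextPoint z b) (by simpa using hlen) (funext fun s => ?_)]
    rcases le_or_gt s z.2 with hs | hs
    · have hs' : s ≤ (nextPoint z b).2 := by simp only [nextPoint]; omega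
      rw [walk_of_le hs', walk_of_le hs']
    · rw [← walk_cons_of_lt hs, ← walk_cons_of_lt hs, h]

lemma IsWalk.exists_walk_eq {f : ℤ → ℤ} (hf : IsWalk f) (n : ℕ) (hz : f z.2 = z.1) :
    ∃ l : List Bool, l.length = n ∧ ∀ s, z.2 ≤ s → s ≤ z.2 + n → walk z l s = f s := by
  induction n generalizing z with
  | zero =>
    refine ⟨[], rfl, fun s h0 h1 => ?_⟩
    obtain rfl : s = z.2 := by omega
    exact hz.symm
  | succ n ih =>
    obtain ⟨b, hb⟩ : ∃ b, f (z.2 + 1) = (nextPoint z b).1 := by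
      rcases hf z.2 with h | h
      · exact ⟨false, by simp [nextPoint, h, hz]⟩
      · exact ⟨true, by simp [nextPoint, h, hz]⟩
    obtain ⟨l, hl, hwalk⟩ := ih (z := nextPoint z b) hb
    refine ⟨b :: l, by rw [List.length_cons, hl], fun s h0 h1 => ?_⟩
    rcases h0.eq_or_lt with rfl | h0
    · rw [walk_of_le le_rfl, hz]
    · rw [walk_cons_of_lt h0]
      push_cast at h1
      exact hwalk s h0 (by simp only [nextPoint]; omega)

end walk

lemma sum_elemWeight_nextPoint (p : ℝ) (S : Set (ℤ × ℤ)) (z : ℤ × ℤ) :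
    ∑ b, elemWeight p S z (nextPoint z b) = 1 := by
  by_cases h : (z.1 + 1, z.2 + 1) ∈ S <;> simp [elemWeight, nextPoint, h]

lemma sum_ofReal_elemWeight_nextPoint (hp0 : 0 ≤ p) (hp1 : p ≤ 1) (S : Set (ℤ × ℤ)) (z : ℤ × ℤ) :
    ∑ b, ENNReal.ofReal (elemWeight p S z (nextPoint z b)) = 1 := by
  rw [← ENNReal.ofReal_sum_of_nonneg fun _ _ => elemWeight_nonneg hp0 hp1 _ _ _,
    sum_elemWeight_nextPoint, ENNReal.ofReal_one]

open Classical in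
/-- The weight of the word `l` for a walker who starts at `z` and is blocked by `S`, provided that
the word ends when the walker leaves `L` for the first time. -/
noncomputable def exitWeight (p : ℝ) (S L : Set (ℤ × ℤ)) (z : ℤ × ℤ) (l : List Bool) : ℝ≥0∞ :=
  if FirstExit L (walk z l) z.2 (z.2 + l.length) then
    ENNReal.ofReal (∏ s ∈ Finset.Ico z.2 (z.2 + l.length),
      elemWeight p S (walk z l s, s) (walk z l (s + 1), s + 1)) else 0

section exitWeight
variable {S L : Set (ℤ × ℤ)} {z : ℤ × ℤ}

lemma exitWeight_nil_of_mem (hz : z ∈ L) : exitWeight p S L z [] = 0 :=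
  if_neg fun h => h.2.2 (by simpa [walk] using hz)

lemma exitWeight_nil_of_notMem (hz : z ∉ L) : exitWeight p S L z [] = 1 := by
  have hexit : FirstExit L (walk z []) z.2 (z.2 + ([] : List Bool).length) :=
    ⟨by simp, fun s h0 h1 => absurd h1 (by simpa using h0), by simpa [walk] using hz⟩
  rw [exitWeight, if_pos hexit]
  simp

lemma exitWeight_cons_of_notMem (hz : z ∉ L) (b : Bool) (l : List Bool) :
    exitWeight p S L z (b :: l) = 0 := by
  refine if_neg fun h => hz ?_
  have hmem := h.2.1 z.2 le_rfl (by simp only [List.length_cons]; omega)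
  rwa [walk_of_le le_rfl] at hmem

lemma exitWeight_cons_of_mem (hp0 : 0 ≤ p) (hp1 : p ≤ 1) (hz : z ∈ L) (b : Bool) (l : List Bool) :
    exitWeight p S L z (b :: l) =
      ENNReal.ofReal (elemWeight p S z (nextPoint z b)) * exitWeight p S L (nextPoint z b) l := by
  have htail (s) (hs : z.2 + 1 ≤ s) : walk z (b :: l) s = walk (nextPoint z b) l s :=
    walk_cons_of_lt hs
  have hexit : FirstExit L (walk z (b :: l)) z.2 ((nextPoint z b).2 + l.length) ↔
      FirstExit L (walk (nextPoint z b) l) (nextPoint z b).2 ((nextPoint z b).2 + l.length) := by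
    rw [firstExit_iff_of_mem (by rwa [walk_of_le le_rfl])]
    exact firstExit_congr fun s hs _ => htail s hs
  have hlt : z.2 < (nextPoint z b).2 + l.length := by simp only [nextPoint]; omega
  have hprod : ∏ s ∈ Finset.Ico z.2 ((nextPoint z b).2 + l.length),
        elemWeight p S (walk z (b :: l) s, s) (walk z (b :: l) (s + 1), s + 1) =
      elemWeight p S z (nextPoint z b) *
        ∏ s ∈ Finset.Ico (nextPoint z b).2 ((nextPoint z b).2 + l.length),
          elemWeight p S (walk (nextPoint z b) l s, s) (walk (nextPoint z b) l (s + 1), s + 1) := by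
    rw [← Finset.insert_Ico_add_one_left_eq_Ico hlt, Finset.prod_insert (by simp),
      walk_of_le le_rfl, walk_cons_next]
    refine congrArg _ (Finset.prod_congr rfl fun s hs => ?_)
    have hs : z.2 + 1 ≤ s := (Finset.mem_Ico.1 hs).1
    rw [htail s hs, htail (s + 1) (by omega)]
  rw [exitWeight, exitWeight, endTime_cons, hprod, mul_ite, mul_zero,
    ENNReal.ofReal_mul (elemWeight_nonneg hp0 hp1 S z (nextPoint z b))]
  classical exact if_congr hexit rfl rfl

lemma tsum_exitWeight_of_notMem (hz : z ∉ L) : ∑' l, exitWeight p S L z l = 1 := by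
  simp only [tsum_list, exitWeight_nil_of_notMem hz, exitWeight_cons_of_notMem hz, tsum_zero,
    add_zero]

lemma tsum_exitWeight_of_mem (hp0 : 0 ≤ p) (hp1 : p ≤ 1) (hz : z ∈ L) :
    ∑' l, exitWeight p S L z l = ∑ b, ENNReal.ofReal (elemWeight p S z (nextPoint z b)) *
      ∑' l, exitWeight p S L (nextPoint z b) l := by
  simp only [tsum_list (exitWeight p S L z), exitWeight_nil_of_mem hz,
    exitWeight_cons_of_mem hp0 hp1 hz, ENNReal.tsum_mul_left, tsum_fintype, zero_add]

lemma tsum_exitWeight_length_le_le_one (hp0 : 0 ≤ p) (hp1 : p ≤ 1) (S L : Set (ℤ × ℤ)) (n : ℕ)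
    (z : ℤ × ℤ) : ∑' l : List Bool, (if l.length ≤ n then exitWeight p S L z l else 0) ≤ 1 := by
  induction n generalizing z with
  | zero =>
    rw [tsum_list]
    by_cases hz : z ∈ L
    · simp [exitWeight_nil_of_mem hz]
    · simp [exitWeight_nil_of_notMem hz]
  | succ n ih =>
    rw [tsum_list]
    by_cases hz : z ∈ L
    · simp only [exitWeight_nil_of_mem hz, exitWeight_cons_of_mem hp0 hp1 hz, ite_self, zero_add,
        List.length_cons, add_le_add_iff_right, ← mul_ite_zero, ENNReal.tsum_mul_left, tsum_fintype]
      calc ∑ b, ENNReal.ofReal (elemWeight p S z (nextPoint z b)) *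
            ∑' l : List Bool, (if l.length ≤ n then exitWeight p S L (nextPoint z b) l else 0)
        _ ≤ ∑ b, ENNReal.ofReal (elemWeight p S z (nextPoint z b)) * 1 := by
          gcongr
          exact ih _
        _ = 1 := by simp only [mul_one, sum_ofReal_elemWeight_nextPoint hp0 hp1]
    · simp [exitWeight_nil_of_notMem hz, exitWeight_cons_of_notMem hz]

lemma tsum_exitWeight_le_one (hp0 : 0 ≤ p) (hp1 : p ≤ 1) (S L : Set (ℤ × ℤ)) (z : ℤ × ℤ) :
    ∑' l, exitWeight p S L z l ≤ 1 := by
  rw [ENNReal.tsum_eq_iSup_sum]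
  refine iSup_le fun s => ?_
  calc ∑ l ∈ s, exitWeight p S L z l
    _ = ∑ l ∈ s, if l.length ≤ s.sup List.length then exitWeight p S L z l else 0 :=
      Finset.sum_congr rfl fun l hl => (if_pos (Finset.le_sup hl)).symm
    _ ≤ ∑' l : List Bool, if l.length ≤ s.sup List.length then exitWeight p S L z l else 0 :=
      ENNReal.sum_le_tsum s
    _ ≤ 1 := tsum_exitWeight_length_le_le_one hp0 hp1 S L _ z

end exitWeight

lemma eq_zero_of_abs_le_mul_abs_succ {u : ℕ → ℝ} {r C : ℝ} (hr0 : 0 ≤ r) (hr1 : r < 1)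
    (hC : ∀ n, |u n| ≤ C) (hu : ∀ n, |u n| ≤ r * |u (n + 1)|) : u 0 = 0 := by
  have hgeom (n : ℕ) : |u 0| ≤ r ^ n * |u n| := by
    induction n with
    | zero => simp
    | succ n ih =>
      calc |u 0| ≤ r ^ n * |u n| := ih
        _ ≤ r ^ n * (r * |u (n + 1)|) := by gcongr; exact hu n
        _ = r ^ (n + 1) * |u (n + 1)| := by ring
  have hlim : Filter.Tendsto (fun n => r ^ n * C) Filter.atTop (nhds 0) := by
    simpa using (tendsto_pow_atTop_nhds_zero_of_lt_one hr0 hr1).mul_const C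
  refine abs_nonpos_iff.1 (ge_of_tendsto' hlim fun n => (hgeom n).trans ?_)
  gcongr
  exact hC n

/-- Functions that vanish outside of `L` and are harmonic in `L` for a walker who is blocked by
`S`. The probability to stay in `L` forever is such a function of the starting point. -/
def IsHarmonicInside (p : ℝ) (S L : Set (ℤ × ℤ)) (u : ℤ × ℤ → ℝ) : Prop :=
  (∀ z ∉ L, u z = 0) ∧
    ∀ z ∈ L, u z = ∑ b, elemWeight p S z (nextPoint z b) * u (nextPoint z b)

namespace IsHarmonicInside
variable {S L : Set (ℤ × ℤ)} {u : ℤ × ℤ → ℝ}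

-- In the absence of obstacles, a walker stays at the same site with probability `1 - p < 1`.
lemma eq_zero_of_column (hp0 : 0 < p) (hp1 : p ≤ 1) (hu : IsHarmonicInside p S L u) {C : ℝ}
    (hC : ∀ z, |u z| ≤ C) {x t : ℤ} (hS : ∀ s, t ≤ s → (x + 1, s + 1) ∉ S)
    (hright : ∀ s, t ≤ s → u (x + 1, s) = 0) : u (x, t) = 0 := by
  have hstep (s : ℤ) (hs : t ≤ s) : |u (x, s)| ≤ (1 - p) * |u (x, s + 1)| := by
    by_cases hmem : (x, s) ∈ L
    · rw [hu.2 _ hmem]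
      simp [elemWeight, nextPoint, hS s hs, hright (s + 1) (by omega), abs_mul, abs_of_nonneg,
        hp1]
    · rw [hu.1 _ hmem, abs_zero]
      exact mul_nonneg (by linarith) (abs_nonneg _)
  have h := eq_zero_of_abs_le_mul_abs_succ (u := fun n => u (x, t + n)) (r := 1 - p)
    (by linarith) (by linarith) (fun n => hC _) fun n => by
      simpa only [Nat.cast_add, Nat.cast_one, add_assoc] using hstep (t + n) (by omega)
  simpa using h

lemma eq_zero_of_le_time (hp0 : 0 < p) (hp1 : p ≤ 1) (hu : IsHarmonicInside p S L u) {C : ℝ}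
    (hC : ∀ z, |u z| ≤ C) {M T : ℤ} (hL : ∀ z ∈ L, T ≤ z.2 → z.1 ≤ M) (hS : ∀ z ∈ S, z.2 ≤ T)
    {x t : ℤ} (ht : T ≤ t) : u (x, t) = 0 := by
  induction hn : (M + 1 - x).toNat generalizing x t with
  | zero =>
    refine hu.1 _ fun h => ?_
    have hxM : x ≤ M := hL _ h ht
    omega
  | succ n ih =>
    refine hu.eq_zero_of_column hp0 hp1 hC (fun s hs h => ?_) fun s hs =>
      ih (ht.trans hs) (by omega)
    have hsT : s + 1 ≤ T := hS _ h
    omega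

theorem eq_zero (hp0 : 0 < p) (hp1 : p ≤ 1) (hu : IsHarmonicInside p S L u) {C : ℝ}
    (hC : ∀ z, |u z| ≤ C) {M T : ℤ} (hL : ∀ z ∈ L, T ≤ z.2 → z.1 ≤ M) (hS : ∀ z ∈ S, z.2 ≤ T)
    (z : ℤ × ℤ) : u z = 0 := by
  rcases z with ⟨x, t⟩
  rcases le_total T t with ht | ht
  · exact hu.eq_zero_of_le_time hp0 hp1 hC hL hS ht
  induction t, ht using Int.leInductionDown generalizing x with
  | base => exact hu.eq_zero_of_le_time hp0 hp1 hC hL hS le_rfl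
  | pred t _ ih =>
    by_cases hmem : (x, t - 1) ∈ L
    · rw [hu.2 _ hmem]
      simp [nextPoint, ih]
    · exact hu.1 _ hmem

end IsHarmonicInside

lemma isHarmonicInside_one_sub_tsum_exitWeight (hp0 : 0 ≤ p) (hp1 : p ≤ 1) (S L : Set (ℤ × ℤ)) :
    IsHarmonicInside p S L fun z => 1 - (∑' l, exitWeight p S L z l).toReal := by
  have hfin (z : ℤ × ℤ) : ∑' l, exitWeight p S L z l ≠ ∞ :=
    ne_top_of_le_ne_top ENNReal.one_ne_top (tsum_exitWeight_le_one hp0 hp1 S L z)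
  refine ⟨fun z hz => by simp [tsum_exitWeight_of_notMem hz], fun z hz => ?_⟩
  beta_reduce
  rw [tsum_exitWeight_of_mem hp0 hp1 hz, ENNReal.toReal_sum fun b _ =>
    ENNReal.mul_ne_top ENNReal.ofReal_ne_top (hfin _)]
  simp only [ENNReal.toReal_mul, ENNReal.toReal_ofReal (elemWeight_nonneg hp0 hp1 _ _ _), mul_sub,
    mul_one, Finset.sum_sub_distrib, sum_elemWeight_nextPoint]

theorem tsum_exitWeight (hp0 : 0 < p) (hp1 : p ≤ 1) {S L : Set (ℤ × ℤ)}
    (hL : ∃ M T : ℤ, ∀ z ∈ L, T ≤ z.2 → z.1 ≤ M) (hS : ∃ T : ℤ, ∀ z ∈ S, z.2 ≤ T) (z : ℤ × ℤ) :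
    ∑' l, exitWeight p S L z l = 1 := by
  obtain ⟨M, T₁, hL⟩ := hL
  obtain ⟨T₂, hS⟩ := hS
  have hle (z : ℤ × ℤ) : (∑' l, exitWeight p S L z l).toReal ≤ 1 := by
    simpa using ENNReal.toReal_mono ENNReal.one_ne_top (tsum_exitWeight_le_one hp0.le hp1 S L z)
  have hbound (z : ℤ × ℤ) : |1 - (∑' l, exitWeight p S L z l).toReal| ≤ 1 := by
    rw [abs_of_nonneg (sub_nonneg.2 (hle z))]
    exact sub_le_self 1 ENNReal.toReal_nonneg
  have hzero := (isHarmonicInside_one_sub_tsum_exitWeight hp0.le hp1 S L).eq_zero hp0 hp1 hbound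
    (fun z hz ht => hL z hz ((le_max_left T₁ T₂).trans ht))
    (fun z hz => (hS z hz).trans (le_max_right T₁ T₂)) z
  exact (ENNReal.toReal_eq_one_iff _).1 (sub_eq_zero.1 hzero).symm

lemma tsum_prod_eq_one_of_dependsOn {α : Type*} [Nonempty α] {n : ℕ}
    (k : Fin n → (Fin n → α) → ℝ≥0∞) (hdep : ∀ i, DependsOn (k i) (Set.Iic i))
    (hk : ∀ i w, ∑' a, k i (Function.update w i a) = 1) : ∑' w, ∏ i, k i w = 1 := by
  induction n with
  | zero => simp
  | succ n ih =>
    obtain ⟨a₀⟩ := ‹Nonempty α›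
    let snoc (v : Fin n → α) (a : α) : Fin (n + 1) → α := Fin.snoc (α := fun _ => α) v a
    have hsnoc {v v' : Fin n → α} {a a' : α} {i : Fin n} (h : ∀ j ≤ i, v j = v' j) :
        k i.castSucc (snoc v a) = k i.castSucc (snoc v' a') :=
      hdep _ fun j hj => by
        obtain ⟨j, rfl⟩ := Fin.exists_castSucc_eq.2 (hj.trans_lt i.castSucc_lt_last).ne
        simpa only [snoc, Fin.snoc_castSucc] using h j hj
    have hlast (v : Fin n → α) : ∑' a, k (Fin.last n) (snoc v a) = 1 := by
      simpa only [snoc, Fin.update_snoc_last] using hk (Fin.last n) (snoc v a₀)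
    calc ∑' w, ∏ i, k i w
      _ = ∑' (v : Fin n → α) (a : α), ∏ i, k i (snoc v a) := by
        rw [← (Fin.snocEquiv fun _ => α).tsum_eq, ENNReal.tsum_prod', ENNReal.tsum_comm]
        rfl
      _ = ∑' (v : Fin n → α) (a : α),
          (∏ i : Fin n, k i.castSucc (snoc v a₀)) * k (Fin.last n) (snoc v a) := by
        refine tsum_congr fun v => tsum_congr fun a => ?_
        rw [Fin.prod_univ_castSucc, Finset.prod_congr rfl fun i _ => hsnoc fun _ _ => rfl]
      _ = ∑' v : Fin n → α, ∏ i : Fin n, k i.castSucc (snoc v a₀) := by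
        simp only [ENNReal.tsum_mul_left, hlast, mul_one]
      _ = 1 := by
        refine ih _ (fun i v v' h => hsnoc h) fun i v => ?_
        simpa only [snoc, Fin.snoc_update] using hk i.castSucc (snoc v a₀)

instance (c : Config N) : Unique (NPath c c) where
  default := ⟨fun i _ => (c i).1, fun _ => le_rfl, fun _ _ _ => rfl, fun _ _ _ => rfl⟩
  uniq π := NPath.ext <| funext₂ fun i s =>
    (le_total s (c i).2).elim (π.pos_start i s) (π.pos_end i s)

open Classical in
/-- The weight of an `N`-path from `c₀`, provided that it ends when each particle leaves its domain
for the first time. -/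
noncomputable def exitPathWeight {c₀ : Config N} (p : ℝ) (B : Set (ℤ × ℤ))
    (x : (c : Config N) × NPath c₀ c) : ℝ≥0∞ :=
  if ∀ i, FirstExit (under (NBoundary N B i)) (x.2.pos i) (c₀ i).2 (x.1 i).2 then
    ENNReal.ofReal (pathWeight p c₀ x.1 x.2.pos) else 0

/-- The `N`-paths from `c₀` that are cut into an `N`-path to the boundary and exit steps. -/
abbrev SplitExitPath (B : Set (ℤ × ℤ)) (c₀ : Config N) : Type :=
  (e : ExitStep N B) × NPath c₀ e.1.1

namespace SplitExitPath
variable {c₀ : Config N}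

/-- The exit path that is put together from the pieces. -/
def glue (x : SplitExitPath B c₀) : (c : Config N) × NPath c₀ c :=
  ⟨x.1.2.1, SplitPath.glue ⟨x.1, x.2, default⟩⟩

/-- The product of the weights of the two pieces. -/
noncomputable def weight (p : ℝ) (x : SplitExitPath B c₀) : ℝ :=
  pathWeight p c₀ x.1.1.1 x.2.pos * stepWeight p x.1.1.1 x.1.2.1

lemma exitPathWeight_glue (hB : IsBoundary B) (x : SplitExitPath B c₀) :
    exitPathWeight p B x.glue = ENNReal.ofReal (x.weight p) := by
  let y : SplitPath B c₀ x.1.2.1 := ⟨x.1, x.2, default⟩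
  have hweight : y.weight p = x.weight p := by
    simp only [y, weight, SplitPath.weight, pathWeight_self, mul_one]
  have hglue : pathWeight p c₀ x.glue.1 x.glue.2.pos = x.weight p :=
    (y.pathWeight_glue hB).trans hweight
  rw [exitPathWeight, hglue]
  by_cases hx : x.weight p = 0
  · rw [hx, ENNReal.ofReal_zero, ite_self]
  · exact if_pos fun i => y.firstExit_glue hB (hweight ▸ hx) i

lemma injective_glue : Function.Injective (glue (B := B) (c₀ := c₀)) := by
  rintro ⟨⟨c', c'', hc''⟩, π⟩ ⟨⟨d', d'', hd''⟩, ρ⟩ h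
  obtain rfl : c'' = d'' := congrArg Sigma.fst h
  have hsplit := SplitPath.eq_of_glue_eq (c := c'') (x := ⟨⟨c', c'', hc''⟩, π, default⟩)
    (y := ⟨⟨d', c'', hd''⟩, ρ, default⟩) (eq_of_heq (Sigma.mk.inj h).2) fun _ => rfl
  exact congrArg (fun x : SplitPath B c₀ c'' => (⟨x.1, x.2.1⟩ : SplitExitPath B c₀)) hsplit

lemma exists_glue_eq (hB : IsBoundary B) (hc₀ : Admissible c₀)
    (hc₀B : ∀ i, c₀ i ∈ under (NBoundary N B i)) {x : (c : Config N) × NPath c₀ c}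
    (hx : exitPathWeight p B x ≠ 0) : ∃ y : SplitExitPath B c₀, y.glue = x := by
  obtain ⟨c, π⟩ := x
  classical
  rw [exitPathWeight, ite_ne_right_iff] at hx
  obtain ⟨hexit, hπ⟩ := hx
  have hπ : pathWeight p c₀ c π.pos ≠ 0 := fun h => hπ (by simp only [h, ENNReal.ofReal_zero])
  have hc (i : Fin N) : c i ∉ under (NBoundary N B i) := by
    have hout := (hexit i).2.2
    rwa [π.pos_end_time] at hout
  obtain ⟨⟨⟨c', c'', hc''⟩, ρ, σ⟩, rfl⟩ := SplitPath.exists_glue_eq hB hc₀ hc₀B hc π hπ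
  have htime (i : Fin N) : (c'' i).2 = (c i).2 :=
    (SplitPath.firstExit_glue hB _ (by rwa [← SplitPath.pathWeight_glue hB]) i).unique (hexit i)
  have hnext (i : Fin N) : (c'' i).2 = (c'.1 i).2 + 1 := (hc'' i).1
  obtain rfl : c'' = c := funext fun i => Prod.ext (by
    rw [← NPath.glue_pos_right hnext ρ σ, htime, NPath.pos_end_time]) (htime i)
  exact ⟨⟨⟨c', c'', hc''⟩, ρ⟩, by rw [glue, Subsingleton.elim default σ]⟩

lemma tsum_weight (hB : IsBoundary B) (hc₀ : Admissible c₀)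
    (hc₀B : ∀ i, c₀ i ∈ under (NBoundary N B i)) :
    ∑' x : SplitExitPath B c₀, ENNReal.ofReal (x.weight p) =
      ∑' x : (c : Config N) × NPath c₀ c, exitPathWeight p B x := by
  simp only [← exitPathWeight_glue hB]
  exact injective_glue.tsum_eq fun _ hx => exists_glue_eq hB hc₀ hc₀B hx

end SplitExitPath

/-- The `N`-path from `c₀` whose `i`-th particle follows the word `w i`. -/
def pathOfWords (c₀ : Config N) (w : Fin N → List Bool) : (c : Config N) × NPath c₀ c where
  fst i := (walk (c₀ i) (w i) ((c₀ i).2 + (w i).length), (c₀ i).2 + (w i).length)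
  snd :=
    { pos i := walk (c₀ i) (w i)
      time_le i := by simp
      pos_start _ _ hs := walk_of_le hs
      pos_end _ _ hs := walk_of_ge hs }

section pathOfWords
variable {c₀ : Config N}

lemma injective_pathOfWords : Function.Injective (pathOfWords c₀) := by
  intro w w' h
  funext i
  have htime := congrArg (fun x : (c : Config N) × NPath c₀ c => (x.1 i).2) h
  have hpos := congrArg (fun x : (c : Config N) × NPath c₀ c => x.2.pos i) h
  simp only [pathOfWords] at htime hpos
  exact eq_of_walk_eq (by omega) hpos

lemma exists_pathOfWords_eq {c : Config N} (π : NPath c₀ c) (hπ : ∀ i, IsWalk (π.pos i)) :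
    ∃ w, pathOfWords c₀ w = ⟨c, π⟩ := by
  have hduration (i : Fin N) : (c₀ i).2 + (((c i).2 - (c₀ i).2).toNat : ℕ) = (c i).2 := by
    have := π.time_le i
    omega
  choose w hlen hw using fun i =>
    (hπ i).exists_walk_eq ((c i).2 - (c₀ i).2).toNat (π.pos_start_time i)
  simp only [hduration] at hw
  have htime (i : Fin N) : (c₀ i).2 + (w i).length = (c i).2 := by rw [hlen, hduration]
  have hend (i : Fin N) : walk (c₀ i) (w i) (c i).2 = (c i).1 := by
    rw [hw i _ (π.time_le i) le_rfl, π.pos_end_time]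
  have hconfig : (pathOfWords c₀ w).1 = c := funext fun i =>
    Prod.ext (by simp only [pathOfWords, htime, hend]) (htime i)
  have hpos : (pathOfWords c₀ w).2.pos = π.pos := funext₂ fun i s => by
    change walk (c₀ i) (w i) s = π.pos i s
    rcases le_total s (c₀ i).2 with h0 | h0
    · rw [walk_of_le h0, π.pos_start i s h0]
    rcases le_total s (c i).2 with h1 | h1
    · exact hw i s h0 h1
    · rw [walk_of_ge (by rwa [htime]), htime, hend, π.pos_end i s h1]
  refine ⟨w, Sigma.ext hconfig ?_⟩
  subst hconfig
  exact heq_of_eq (NPath.ext hpos)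

lemma exitPathWeight_pathOfWords (hp0 : 0 ≤ p) (hp1 : p ≤ 1) (B : Set (ℤ × ℤ))
    (w : Fin N → List Bool) :
    exitPathWeight p B (pathOfWords c₀ w) =
      ∏ i, exitWeight p (precedingPath c₀ (pathOfWords c₀ w).1 (pathOfWords c₀ w).2.pos i)
        (under (NBoundary N B i)) (c₀ i) (w i) := by
  classical
  simp only [exitWeight, Fintype.prod_ite_zero]
  rw [exitPathWeight, pathWeight, ENNReal.ofReal_prod_of_nonneg fun i _ =>
    Finset.prod_nonneg fun s _ => elemWeight_nonneg hp0 hp1 _ _ _]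
  congr

lemma precedingPath_pathOfWords_congr {w w' : Fin N → List Bool} {i : Fin N}
    (h : ∀ j < i, w j = w' j) :
    precedingPath c₀ (pathOfWords c₀ w).1 (pathOfWords c₀ w).2.pos i =
      precedingPath c₀ (pathOfWords c₀ w').1 (pathOfWords c₀ w').2.pos i := by
  ext z
  refine exists_congr fun j => and_congr_right fun hji => ?_
  simp only [pathPoints, pathOfWords, h j (Fin.lt_def.2 (by omega))]

lemma exists_time_bound_precedingPath (c₀ c : Config N) (pos : Fin N → ℤ → ℤ) (i : Fin N) :
    ∃ T : ℤ, ∀ z ∈ precedingPath c₀ c pos i, z.2 ≤ T := by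
  by_cases h : ∃ j : Fin N, j.val + 1 = i.val
  · obtain ⟨j, hj⟩ := h
    refine ⟨(c j).2, ?_⟩
    rintro z ⟨j', hj', -, hz, -⟩
    obtain rfl : j' = j := Fin.ext (by omega)
    exact hz
  · exact ⟨0, fun z ⟨j, hj, _⟩ => absurd ⟨j, hj⟩ h⟩

lemma support_exitPathWeight_subset_range :
    Function.support (exitPathWeight p B) ⊆ Set.range (pathOfWords c₀) := by
  rintro ⟨c, π⟩ hx
  refine exists_pathOfWords_eq π fun i => π.isWalk (p := p) (fun h => hx ?_) i
  simp only [exitPathWeight, h, ENNReal.ofReal_zero, ite_self]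

theorem tsum_exitPathWeight (hp0 : 0 < p) (hp1 : p ≤ 1) (hB : IsBoundary B) (c₀ : Config N) :
    ∑' x : (c : Config N) × NPath c₀ c, exitPathWeight p B x = 1 := by
  rw [← injective_pathOfWords.tsum_eq support_exitPathWeight_subset_range]
  simp only [exitPathWeight_pathOfWords hp0.le hp1]
  refine tsum_prod_eq_one_of_dependsOn
    (fun i w => exitWeight p (precedingPath c₀ (pathOfWords c₀ w).1 (pathOfWords c₀ w).2.pos i)
      (under (NBoundary N B i)) (c₀ i) (w i)) (fun i w w' h => ?_) fun i w => ?_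
  · simp only [h i Set.self_mem_Iic, precedingPath_pathOfWords_congr fun j hj => h j hj.le]
  · have hpreceding (l : List Bool) := precedingPath_pathOfWords_congr (c₀ := c₀)
      fun j (hj : j < i) => Function.update_of_ne hj.ne l w
    simp only [hpreceding, Function.update_self]
    exact tsum_exitWeight hp0 hp1 (hB.isBoundary_NBoundary i).exists_bound
      (exists_time_bound_precedingPath _ _ _ _) _

end pathOfWords

lemma stepWeight_nonneg (hp0 : 0 ≤ p) (hp1 : p ≤ 1) (c' c'' : Config N) :
    0 ≤ stepWeight p c' c'' :=
  pathWeight_nonneg hp0 hp1 _ _ _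

lemma GGF_nonneg (hp0 : 0 ≤ p) (hp1 : p ≤ 1) (c c₀ : Config N) : 0 ≤ GGF p c c₀ :=
  tsum_nonneg fun _ => pathWeight_nonneg hp0 hp1 _ _ _

lemma exitProb_nonneg (hp0 : 0 ≤ p) (hp1 : p ≤ 1) (B : Set (ℤ × ℤ)) (c' : Config N) :
    0 ≤ exitProb p B c' :=
  tsum_nonneg fun _ => stepWeight_nonneg hp0 hp1 _ _

lemma ofReal_GGF (hp0 : 0 ≤ p) (hp1 : p ≤ 1) (c c₀ : Config N) :
    ENNReal.ofReal (GGF p c c₀) = ∑' π : NPath c₀ c, ENNReal.ofReal (pathWeight p c₀ c π.pos) :=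
  ENNReal.ofReal_tsum_of_nonneg (fun _ => pathWeight_nonneg hp0 hp1 _ _ _)
    (summable_pathWeight c₀ c)

lemma ofReal_exitProb (hp0 : 0 ≤ p) (hp1 : p ≤ 1) (B : Set (ℤ × ℤ)) (c' : Config N) :
    ENNReal.ofReal (exitProb p B c') =
      ∑' c'' : ExitTarget B c', ENNReal.ofReal (stepWeight p c' c''.1) :=
  ENNReal.ofReal_tsum_of_nonneg (fun _ => stepWeight_nonneg hp0 hp1 _ _)
    (summable_of_hasFiniteSupport (finite_support_stepWeight B c'))

lemma tsum_ofReal_exitProb_mul_GGF (hp0 : 0 ≤ p) (hp1 : p ≤ 1) (c₀ : Config N) :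
    ∑' c : BoundaryConfig N B, ENNReal.ofReal (exitProb p B c.1 * GGF p c.1 c₀) =
      ∑' x : SplitExitPath B c₀, ENNReal.ofReal (x.weight p) := by
  simp only [ENNReal.tsum_sigma', SplitExitPath.weight,
    ENNReal.ofReal_mul (pathWeight_nonneg hp0 hp1 _ _ _), ENNReal.tsum_mul_left,
    ENNReal.tsum_mul_right, ← ofReal_exitProb hp0 hp1, ← ofReal_GGF hp0 hp1,
    ENNReal.ofReal_mul (exitProb_nonneg hp0 hp1 _ _)]
  exact tsum_congr fun c => mul_comm _ _

theorem exists_pmf_exitProb_mul_GGF (hp0 : 0 < p) (hp1 : p ≤ 1) (hB : IsBoundary B)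
    {c₀ : Config N} (hc₀ : Admissible c₀) (hc₀B : ∀ i, c₀ i ∈ under (NBoundary N B i)) :
    ∃ μ : PMF (BoundaryConfig N B), ∀ c, exitProb p B c.1 * GGF p c.1 c₀ = (μ c).toReal := by
  have hsum : ∑' c : BoundaryConfig N B, ENNReal.ofReal (exitProb p B c.1 * GGF p c.1 c₀) = 1 := by
    rw [tsum_ofReal_exitProb_mul_GGF hp0.le hp1, SplitExitPath.tsum_weight hB hc₀ hc₀B,
      tsum_exitPathWeight hp0 hp1 hB]
  refine ⟨⟨_, hsum ▸ ENNReal.summable.hasSum⟩, fun c => (ENNReal.toReal_ofReal ?_).symm⟩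
  exact mul_nonneg (exitProb_nonneg hp0.le hp1 B c.1) (GGF_nonneg hp0.le hp1 c.1 c₀)

end TASEP

theorem mainTheorem3_general (N : ℕ) (p : ℝ) (B : Set (ℤ × ℤ)) (hB : TASEP.IsBoundary B)
    (c₀ : TASEP.Config N) (hc₀ : TASEP.Admissible c₀)
    (hc₀B : ∀ i, c₀ i ∈ TASEP.under (TASEP.NBoundary N B i)) :
    (0 < p → p ≤ 1 → ∃ μ : PMF (TASEP.BoundaryConfig N B), ∀ c : TASEP.BoundaryConfig N B,
      TASEP.exitProb p B c.1 * TASEP.GGF p c.1 c₀ = (μ c).toReal) ∧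
    (∀ c : TASEP.Config N, (∀ i, c i ∉ TASEP.under (TASEP.NBoundary N B i)) →
      HasSum
        (fun e : (c' : TASEP.BoundaryConfig N B) × TASEP.ExitTarget B c'.1 =>
          TASEP.GGF p c e.2.1 * TASEP.stepWeight p e.1.1 e.2.1 * TASEP.GGF p e.1.1 c₀)
        (TASEP.GGF p c c₀)) :=
  ⟨fun hp0 hp1 => TASEP.exists_pmf_exitProb_mul_GGF hp0 hp1 hB hc₀ hc₀B,
    fun _ hc => TASEP.hasSum_GGF_mul_stepWeight_mul_GGF hB hc₀ hc₀B hc⟩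

theorem mainTheorem3 (N : ℕ) (p : ℝ) (hp0 : 0 < p) (hp1 : p < 1)
    (B : Set (ℤ × ℤ)) (hB : TASEP.IsBoundary B)
    (c₀ : TASEP.Config N) (hc₀ : TASEP.Admissible c₀)
    (hc₀B : ∀ i, c₀ i ∈ TASEP.under (TASEP.NBoundary N B i)) :
    (∃ μ : PMF (TASEP.BoundaryConfig N B), ∀ c : TASEP.BoundaryConfig N B,
      TASEP.exitProb p B c.1 * TASEP.GGF p c.1 c₀ = (μ c).toReal) ∧
    (∀ c : TASEP.Config N, TASEP.Admissible c →
      (∀ i, c i ∉ TASEP.under (TASEP.NBoundary N B i)) →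
      HasSum
        (fun e : (c' : TASEP.BoundaryConfig N B) × TASEP.ExitTarget B c'.1 =>
          TASEP.GGF p c e.2.1 * TASEP.stepWeight p e.1.1 e.2.1 * TASEP.GGF p e.1.1 c₀)
        (TASEP.GGF p c c₀)) := by
  obtain ⟨hexit, hsplit⟩ := mainTheorem3_general N p B hB c₀ hc₀ hc₀B
  exact ⟨hexit hp0 hp1.le, fun c _ hc => hsplit c hc⟩
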